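/- A continuous map $p:(\widetilde X,\tilde x_0)\to(X,x_0)$ has the \emph{unique lifting property} if for every connected, locally path connected space $(Y,y_0)$ and every continuous map $f:(Y,y_0)\to(X,x_0)$ with $f_*\pi_1(Y,y_0)\subseteq p_*\pi_1(\widetilde X,\tilde x_0)$ there is a unique continuous map $\tilde f:(Y,y_0)\to(\widetilde X,\tilde x_0)$ with $p\circ\tilde f=f$. If moreover $\widetilde X$ is connected and locally path connected, then $(\widetilde X,p)$ is called a \emph{generalized covering space} of $X$. A \emph{generalized covering group} of a topological group $G$ is a pair $(\widetilde G,p)$ consisting of a topological group $\widetilde G$ and a continuous homomorphism $p:(\widetilde G,\tilde e)\to(G,e)$, where $\tilde e,e$ are the identity elements, such that $(\widetilde G,p)$ is a generalized covering space of $G$. \textbf{Corollary.} If $G$ is a connected, locally path connected topological group and $(\widetilde G,p)$ is a generalized covering group of $G$, then $p:\widetilde G\to G$ is a (Hurewicz) fibration; that is, for every topological space $Y$ and all continuous maps $f:Y\to\widetilde G$ and $H:Y\times[0,1]\to G$ with $H(y,0)=p(f(y))$ for all $y\in Y$, there is a continuous map $K:Y\times[0,1]\to\widetilde G$ with $K(y,0)=f(y)$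 for all $y\in Y$ and $p\circ K=H$. -/

import Mathlib

open scoped unitInterval

universe u v w

/-- A continuous map `p : (E, e₀) → (X, p e₀)` of pointed spaces has the *unique lifting property*
if for every connected, locally path connected pointed space `(Y, y₀)` and every continuous
`f : (Y, y₀) → (X, p e₀)` with `f_* π₁(Y, y₀) ≤ p_* π₁(E, e₀)` there is exactly one continuous
`g : (Y, y₀) → (E, e₀)` with `p ∘ g = f`. -/
def HasUniqueLiftingProperty {E : Type u} {X : Type v} [TopologicalSpace E] [TopologicalSpace X]
    (p : C(E, X)) (e₀ : E) : Prop :=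
  ∀ (Y : Type (max u v)) [TopologicalSpace Y] [ConnectedSpace Y] [LocallyPathConnectedSpace Y]
    (y₀ : Y) (f : C(Y, X)) (hf : f y₀ = p e₀),
    (FundamentalGroup.mapOfEq f hf).range ≤ (FundamentalGroup.map p e₀).range →
      ∃! g : C(Y, E), g y₀ = e₀ ∧ p.comp g = f

/-- `p : (E, e₀) → (X, p e₀)` is a *generalized covering map* (and `(E, p)` is a generalized
covering space of `X`) if `E` is connected and locally path connected and `p` has the unique
lifting property. -/
structure IsGeneralizedCovering {E : Type u} {X : Type v} [TopologicalSpace E]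
    [TopologicalSpace X] (p : C(E, X)) (e₀ : E) : Prop where
  connected : ConnectedSpace E
  locPathConnected : LocallyPathConnectedSpace E
  uniqueLifting : HasUniqueLiftingProperty p e₀

/-- A *generalized covering group* of a topological group `G`: a topological group `G'` with a
continuous homomorphism `p : G' → G` such that `p : (G', 1) → (G, 1)` is a generalized covering. -/
def IsGeneralizedCoveringGroup {G' : Type u} {G : Type v} [Group G'] [TopologicalSpace G']
    [IsTopologicalGroup G'] [Group G] [TopologicalSpace G] [IsTopologicalGroup G]
    (p : G' →ₜ* G) : Prop :=
  IsGeneralizedCovering (p : C(G', G)) 1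

/-- `p : E → B` is a *(Hurewicz) fibration*: it has the homotopy lifting property with respect to
every topological space `Y` (in an arbitrary universe `w`). -/
def IsHurewiczFibration {E : Type u} {B : Type v} [TopologicalSpace E] [TopologicalSpace B]
    (p : C(E, B)) : Prop :=
  ∀ (Y : Type w) [TopologicalSpace Y] (f : C(Y, E)) (H : C(Y × I, B)),
    (∀ y, H (y, 0) = p (f y)) →
      ∃ K : C(Y × I, E), (∀ y, K (y, 0) = f y) ∧ p.comp K = H

/-! The group of paths in $G$ from $1$ is contractible and locally path connected, by shrinking
paths, so the endpoint map lifts to some $L$ into $\widetilde G$ with no condition on $\pi_1$. Left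
translation reduces any homotopy to such paths: $K(y,t)$ is $f(y)$ times $L$ of the path $s\mapsto
H(y,0)^{-1}H(y,ts)$. Hence $Y$ can be arbitrary. -/

open Topology in
/-- A topological group with a continuous multiplicative `I`-action that fixes `1` and
contracts everything to `1` is locally path connected. -/
theorem LocallyPathConnectedSpace.of_unitInterval_contraction {P : Type*} [Group P]
    [TopologicalSpace P] [ContinuousMul P] (c : C(I × P, P)) (c_zero : ∀ x, c (0, x) = 1)
    (c_one : ∀ x, c (1, x) = x) (c_fix : ∀ s, c (s, 1) = 1)
    (c_mul : ∀ s t x, c (s, c (t, x)) = c (s * t, x)) : LocallyPathConnectedSpace P where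
  path_connected_basis x := by
    rw [Filter.hasBasis_self]
    intro W hW
    have hW1 : (x * ·) ⁻¹' W ∈ 𝓝 (1 : P) :=
      (continuous_const_mul x).continuousAt.preimage_mem_nhds (by simpa using hW)
    -- Points whose whole contraction track stays in the translated `W`: a neighbourhood of `1` by
    -- compactness of `I`, and stable under the contraction by `c_mul`.
    set S : Set P := {z | ∀ s ∈ (Set.univ : Set I), c (s, z) ∈ (x * ·) ⁻¹' W} with hS
    have hS1 : S ∈ 𝓝 (1 : P) := by
      refine isCompact_univ.eventually_forall_of_forall_eventually
        (P := fun z s ↦ c (s, z) ∈ (x * ·) ⁻¹' W) fun s _ ↦ ?_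
      have hc : Continuous fun z : P × I ↦ c (z.2, z.1) := by fun_prop
      exact hc.continuousAt.preimage_mem_nhds (by simpa [c_fix] using hW1)
    have hSc : IsPathConnected S := by
      refine ⟨1, mem_of_mem_nhds hS1, fun {z} hz ↦ ⟨⟨⟨fun s ↦ c (s, z), by fun_prop⟩,
        c_zero z, c_one z⟩, fun t s _ ↦ ?_⟩⟩
      change c (s, c (t, z)) ∈ _
      rw [c_mul]
      exact hz _ trivial
    refine ⟨(x * ·) '' S, ?_, hSc.image (continuous_const_mul x), ?_⟩
    · have := (Homeomorph.mulLeft x).isOpenMap.image_mem_nhds hS1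
      simpa using this
    · rintro _ ⟨z, hz, rfl⟩
      simpa [c_one] using hz 1 trivial

/-- The group of continuous paths in `G` starting at `1`. -/
def basedPaths (G : Type*) [Group G] [TopologicalSpace G] [IsTopologicalGroup G] :
    Subgroup C(I, G) where
  carrier := {γ | γ 0 = 1}
  mul_mem' {a b} ha hb := by
    change a 0 * b 0 = 1
    rw [show a 0 = 1 from ha, show b 0 = 1 from hb, one_mul]
  one_mem' := rfl
  inv_mem' {a} ha := by
    change (a 0)⁻¹ = 1
    rw [show a 0 = 1 from ha, inv_one]

namespace basedPaths

variable {G : Type*} [Group G] [TopologicalSpace G] [IsTopologicalGroup G]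

/-- The rescaling `(s, γ) ↦ (t ↦ γ (s * t))` of based paths. -/
def rescale : C(I × basedPaths G, basedPaths G) where
  toFun z := ⟨⟨fun t ↦ (z.2 : C(I, G)) (z.1 * t), by fun_prop⟩, by
    change (z.2 : C(I, G)) (z.1 * 0) = 1
    rw [mul_zero]; exact z.2.2⟩
  continuous_toFun := by
    refine Continuous.subtype_mk (ContinuousMap.continuous_of_continuous_uncurry _ ?_) _
    change Continuous fun w : (I × basedPaths G) × I ↦ (w.1.2 : C(I, G)) (w.1.1 * w.2)
    fun_prop

@[simp]
theorem rescale_apply (s : I) (γ : basedPaths G) (t : I) :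
    (rescale (s, γ) : C(I, G)) t = (γ : C(I, G)) (s * t) := rfl

theorem rescale_zero (γ : basedPaths G) : rescale (0, γ) = 1 :=
  Subtype.ext <| ContinuousMap.ext fun t ↦ by
    rw [rescale_apply, zero_mul]; exact γ.2

theorem rescale_one (γ : basedPaths G) : rescale (1, γ) = γ :=
  Subtype.ext <| ContinuousMap.ext fun t ↦ by rw [rescale_apply, one_mul]

instance : ContinuousMul (basedPaths G) :=
  (basedPaths G).toSubmonoid.continuousMul

instance : LocallyPathConnectedSpace (basedPaths G) :=
  .of_unitInterval_contraction rescale rescale_zero rescale_one (fun _ ↦ rfl) fun s t γ ↦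
    Subtype.ext <| ContinuousMap.ext fun r ↦ by
      simp only [rescale_apply]
      congr 1
      ac_rfl

instance : ContractibleSpace (basedPaths G) :=
  (contractible_iff_id_nullhomotopic _).mpr ⟨1, ⟨ContinuousMap.Homotopy.symm
    { toContinuousMap := rescale
      map_zero_left := rescale_zero
      map_one_left := rescale_one }⟩⟩

end basedPaths

/-- A map with the unique lifting property lifts all pointed maps from contractible, locally
path connected spaces in the universe of its codomain. -/
theorem HasUniqueLiftingProperty.exists_lift_of_contractible {E : Type u} {X : Type v}
    [TopologicalSpace E] [TopologicalSpace X] {p : C(E, X)} {e₀ : E}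
    (hp : HasUniqueLiftingProperty p e₀) {Z : Type v} [TopologicalSpace Z] [ContractibleSpace Z]
    [LocallyPathConnectedSpace Z] (z₀ : Z) (f : C(Z, X)) (hf : f z₀ = p e₀) :
    ∃ g : C(Z, E), g z₀ = e₀ ∧ ∀ z, p (g z) = f z := by
  -- The lifting property only tests spaces in universe `max u v`.
  let h : ULift.{u} Z ≃ₜ Z := Homeomorph.ulift
  have : ContractibleSpace (ULift.{u} Z) := h.contractibleSpace
  have : LocallyPathConnectedSpace (ULift.{u} Z) := h.isOpenEmbedding.locallyPathConnectedSpace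
  obtain ⟨g, ⟨hg₀, hg⟩, -⟩ := hp (ULift.{u} Z) ⟨z₀⟩ (f.comp h) hf (by
    rintro _ ⟨a, rfl⟩
    have ha : a = 1 :=
      (inferInstance : Subsingleton (Path.Homotopic.Quotient (ULift.up z₀) ⟨z₀⟩)).elim _ _
    rw [ha, map_one]
    exact one_mem _)
  exact ⟨g.comp h.symm, hg₀, fun z ↦ DFunLike.congr_fun hg (h.symm z)⟩

theorem mainTheorem9 {G : Type v} {G' : Type u} [Group G] [TopologicalSpace G]
    [IsTopologicalGroup G] [ConnectedSpace G] [LocallyPathConnectedSpace G]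
    [Group G'] [TopologicalSpace G'] [IsTopologicalGroup G'] (p : G' →ₜ* G)
    (hp : IsGeneralizedCoveringGroup p) :
    IsHurewiczFibration.{u, v, w} (p : C(G', G)) := by
  intro Y _ f H hH
  obtain ⟨L, hL₁, hL⟩ := hp.uniqueLifting.exists_lift_of_contractible (1 : basedPaths G)
    ⟨fun γ ↦ (γ : C(I, G)) 1, by fun_prop⟩ (map_one p).symm
  let track : C(Y, basedPaths G) :=
    { toFun := fun y ↦ ⟨⟨fun t ↦ (H (y, 0))⁻¹ * H (y, t), by fun_prop⟩, inv_mul_cancel _⟩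
      continuous_toFun := by
        refine Continuous.subtype_mk (ContinuousMap.continuous_of_continuous_uncurry _ ?_) _
        change Continuous fun w : Y × I ↦ (H (w.1, 0))⁻¹ * H w
        fun_prop }
  -- The path rescaled by `t` ends at $H(y,0)^{-1}H(y,t)$; the factor `f y` restores $H(y,0)$ under
  -- `p`.
  refine ⟨⟨fun w ↦ f w.1 * L (basedPaths.rescale (w.2, track w.1)), by fun_prop⟩,
    fun y ↦ ?_, ContinuousMap.ext fun w ↦ ?_⟩
  · change f y * L (basedPaths.rescale (0, track y)) = f y
    rw [basedPaths.rescale_zero, hL₁, mul_one]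
  · have h₁ : p (L (basedPaths.rescale (w.2, track w.1))) =
        (H (w.1, 0))⁻¹ * H (w.1, w.2 * 1) := hL _
    have h₂ : H (w.1, 0) = p (f w.1) := hH w.1
    change p (f w.1 * L (basedPaths.rescale (w.2, track w.1))) = H w
    rw [map_mul, h₁, mul_one, ← h₂, mul_inv_cancel_left]
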